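/- **Setting.** There are $k\ge 1$ agents and $T\ge 0$ rounds. A realization is a family of bits $\rho=(\rho_i(t))_{i\in[k],\,t\in[T]}$; the bit $\rho_i(t)\in\{0,1\}$ says whether agent $i$ is clicked if she is played at round $t$. A randomized allocation rule $\mathcal A$ draws a random seed $\omega$ from a distribution that depends neither on the bids nor on $\rho$, and, given $\omega$ and the bid vector $b\in[0,\infty)^k$, plays one agent $\mathcal A(b;\rho;t)$ in each round $t$; it is online, i.e. for each seed the choice at round $t$ depends on $\rho$ only through the bits of the agents played in the rounds before $t$. Let $\mathcal A_i(b;\rho;t)$ be the indicator of $\mathcal A(b;\rho;t)=i$, and let $\mathcal C_i(b;\rho)=\sum_t\rho_i(t)\mathcal A_i(b;\rho;t)$ be the number of clicks of agent $i$. A payment rule $\mathcal P$ charges each agent $i$ an amount $\mathcal P_i(b;\rho)$ which depends only on the seed, the bids and the observed clicks (the bits of the agents that were played). The mechanism $(\mathcal A,\mathcal P)$ is *normalized* if $0\le \mathcal P_i(b;\rho)\le b_i\,\mathcal C_i(b;\rho)$ for all $i,b,\rho$ and every seed. It is *weakly truthful* if for every realization $\rho$, agent $i$, value $v_i\ge 0$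 and bid vector $b$, $$\mathbb E\big[v_i\,\mathcal C_i(v_i,b_{-i};\rho)-\mathcal P_i(v_i,b_{-i};\rho)\big]\ \ge\ \mathbb E\big[v_i\,\mathcal C_i(b;\rho)-\mathcal P_i(b;\rho)\big],$$ the expectation being over the seed. The worst-case regret of $\mathcal A$ against an oblivious adversary is $$R(T;v_{\max})=\sup_{\rho,\ v\in[0,v_{\max}]^k}\Big(\max_i v_i\sum_{t=1}^T\rho_i(t)-\sum_{t=1}^T\sum_{i=1}^k v_i\,\rho_i(t)\,\mathbb E[\mathcal A_i(v;\rho;t)]\Big).$$ **Algorithm PSim.** Its parameters are a number $P$ of phases, with $Pk\le T$, and $\varepsilon\ge 0$. The first $PQ$ rounds, $Q=\lfloor T/P\rfloor$, are divided into $P$ phases of $Q$ consecutive rounds. Independently in each phase, $k$ distinct rounds (the exploration rounds) are picked uniformly at random and assigned randomly to the $k$ agents. All weights $w_i(0)$ equal $1$, and $w_i(p)=w_i(p-1)\,(1+\varepsilon)^{\rho_i(t)\,b_i/\max_j b_j}$, where $t$ is the exploration round of phase $p$ assigned to $i$ (the exponent is $0$ if all bids are $0$). In an exploration round the assigned agent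 is played. In every other round of phase $p$ an agent is drawn, with fresh randomness, with probabilities $w_i(p-1)/\sum_j w_j(p-1)$, and the click is discarded; in the remaining rounds $t>PQ$ (all rounds, if $P=0$) the current weights are used in the same way. We take $P=\min\{\lfloor(\log k)^{1/3}(T/k)^{2/3}\rfloor,\lfloor T/k\rfloor\}$ and $\varepsilon=(k\log k/T)^{1/3}$ (with $\varepsilon=0$ if $T=0$). **Statement.** There is an absolute constant $C>0$ such that for all $k\ge 1$ and $T\ge 0$ there is a payment rule $\mathcal P$ for the allocation rule PSim such that the mechanism $(\mathrm{PSim},\mathcal P)$ is normalized and weakly truthful, and for all $v_{\max}\ge 0$ its worst-case regret satisfies $$R(T;v_{\max})\le C\,(k\log k)^{1/3}\,T^{2/3}\,v_{\max}.$$ -/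

import Mathlib

open MeasureTheory

/-! ## The adversarial multi-armed bandit mechanism design problem

There are `k` agents (indexed by `Fin k`) and `T` rounds (indexed by `Fin T`). -/

/-- A realization: the bit `ρ i t` tells whether agent `i` is clicked if she is played at round
`t`.  An oblivious adversary fixes the whole realization in advance. -/
abbrev Realization (k T : ℕ) : Type := Fin k → Fin T → Bool

/-- The bit `ρ i t` as a real number, `0` or `1`. -/
def click {k T : ℕ} (ρ : Realization k T) (i : Fin k) (t : Fin T) : ℝ := if ρ i t then 1 else 0

/-- A randomized online allocation rule.  The random seed is drawn from the probability
distribution `law`, which depends neither on the bids nor on the realization; given the seed,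
`alloc ω b ρ t` is the agent played at round `t` when the bids are `b` and the realization is
`ρ`. -/
structure AllocationRule (k T : ℕ) where
  /-- the space of random seeds -/
  Seed : Type
  /-- the events about the random seed -/
  [seedSpace : MeasurableSpace Seed]
  /-- the distribution of the random seed -/
  law : Measure Seed
  [isProbability : IsProbabilityMeasure law]
  /-- the agent that is played -/
  alloc : Seed → (Fin k → ℝ) → Realization k T → Fin T → Fin k
  measurable_alloc : ∀ b ρ t, Measurable fun ω => alloc ω b ρ t
  /-- Online: the agent chosen at round `t` depends on the realization only through the clicks
  observed before round `t`, i.e. the bits of the agents played in the earlier rounds. -/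
  online : ∀ ω b ρ ρ' t,
    (∀ s, s < t → ρ (alloc ω b ρ s) s = ρ' (alloc ω b ρ s) s) →
      alloc ω b ρ t = alloc ω b ρ' t

attribute [instance] AllocationRule.seedSpace AllocationRule.isProbability

/-- A payment rule for the allocation rule `A`: `pay ω b ρ i` is the total payment charged to
agent `i` at the end of the `T` rounds. -/
structure PaymentRule {k T : ℕ} (A : AllocationRule k T) where
  /-- the payment of each agent -/
  pay : A.Seed → (Fin k → ℝ) → Realization k T → Fin k → ℝ
  measurable_pay : ∀ b ρ i, Measurable fun ω => pay ω b ρ i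
  /-- Payments depend on the realization only through the observed clicks. -/
  observed : ∀ ω b ρ ρ',
    (∀ t, ρ (A.alloc ω b ρ t) t = ρ' (A.alloc ω b ρ t) t) → pay ω b ρ = pay ω b ρ'

namespace AllocationRule

variable {k T : ℕ} (A : AllocationRule k T)

/-- The number of clicks that agent `i` receives. -/
noncomputable def clicks (ω : A.Seed) (b : Fin k → ℝ) (ρ : Realization k T) (i : Fin k) : ℝ :=
  ∑ t, if A.alloc ω b ρ t = i then click ρ i t else 0

/-- The probability, over the random seed, that agent `i` is played at round `t`. -/
noncomputable def playProb (b : Fin k → ℝ) (ρ : Realization k T) (t : Fin T) (i : Fin k) : ℝ :=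
  A.law.real {ω | A.alloc ω b ρ t = i}

/-- The regret for the values `v` and the realization `ρ`: the welfare of the best
time-invariant allocation minus the expected welfare of `A` when all agents bid truthfully. -/
noncomputable def regret [NeZero k] (v : Fin k → ℝ) (ρ : Realization k T) : ℝ :=
  (Finset.univ.sup' Finset.univ_nonempty fun i => v i * ∑ t, click ρ i t) -
    ∑ t, ∑ i, v i * click ρ i t * A.playProb v ρ t i

/-- The worst-case regret over all realizations and all values in `[0, vmax]`. -/
noncomputable def worstCaseRegret [NeZero k] (vmax : ℝ) : EReal :=
  ⨆ (v : Fin k → ℝ) (_ : ∀ i, v i ∈ Set.Icc 0 vmax) (ρ : Realization k T), (A.regret v ρ : EReal)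

end AllocationRule

namespace PaymentRule

variable {k T : ℕ} {A : AllocationRule k T} (P : PaymentRule A)

/-- The mechanism `(A, P)` is normalized: for every random seed, the payment of each agent lies
between `0` and her bid times the number of clicks she got. -/
def IsNormalized : Prop :=
  ∀ (ω : A.Seed) (b : Fin k → ℝ), (∀ j, 0 ≤ b j) → ∀ (ρ : Realization k T) (i : Fin k),
    0 ≤ P.pay ω b ρ i ∧ P.pay ω b ρ i ≤ b i * A.clicks ω b ρ i

/-- The utility of agent `i` with value `x` per click when the bids are `b`. -/
noncomputable def utility (ω : A.Seed) (x : ℝ) (b : Fin k → ℝ) (ρ : Realization k T)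
    (i : Fin k) : ℝ :=
  x * A.clicks ω b ρ i - P.pay ω b ρ i

/-- The mechanism `(A, P)` is weakly truthful: for each realization, bidding her true value
maximizes the utility of an agent in expectation over the random seed, whatever the bids of the
other agents are. -/
def IsWeaklyTruthful : Prop :=
  ∀ (ρ : Realization k T) (i : Fin k) (x : ℝ), 0 ≤ x → ∀ b : Fin k → ℝ, (∀ j, 0 ≤ b j) →
    ∫ ω, P.utility ω x b ρ i ∂A.law ≤ ∫ ω, P.utility ω x (Function.update b i x) ρ i ∂A.law

end PaymentRule

/-! ## The algorithm PSim -/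

/-- The random choice of exploration rounds for `P` phases of `Q` rounds each: `e p i` is the
position, inside phase `p`, of the exploration round assigned to agent `i`.  A uniformly random
`e` picks, independently in each phase, `k` rounds without replacement and assigns them randomly
to the `k` agents. -/
def Exploration (k P Q : ℕ) : Type := Fin P → (Fin k ↪ Fin Q)

namespace Exploration

variable {k P Q T : ℕ}

noncomputable instance : Fintype (Exploration k P Q) := inferInstanceAs (Fintype (Fin P → (Fin k ↪ Fin Q)))

instance : MeasurableSpace (Exploration k P Q) := ⊤

instance : DiscreteMeasurableSpace (Exploration k P Q) := ⟨fun _ => trivial⟩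

theorem nonempty_of_le (h : 0 < P → k ≤ Q) : Nonempty (Exploration k P Q) :=
  ⟨fun p => Fin.castLEEmb (h p.pos)⟩

/-- The exploration round of phase `p` assigned to agent `i`, as a round of the whole game (the
phase `p` consists of the rounds `p * Q, …, p * Q + Q - 1`). -/
def round (hT : P * Q ≤ T) (e : Exploration k P Q) (p : Fin P) (i : Fin k) : Fin T :=
  ⟨p * Q + e p i, by
    have h1 := (e p i).isLt
    have h2 : (p.val + 1) * Q ≤ P * Q := Nat.mul_le_mul_right Q p.isLt
    rw [Nat.add_mul, one_mul] at h2
    omega⟩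

/-- The weight of agent `i` after the first `p` phases: it starts at `1`, and the exploration
round of agent `i` in a phase multiplies it by `(1 + ε) ^ (ρ i t * b i / max b)`. -/
noncomputable def weight [NeZero k] (hT : P * Q ≤ T) (e : Exploration k P Q) (ε : ℝ)
    (b : Fin k → ℝ) (ρ : Realization k T) : ℕ → Fin k → ℝ
  | 0, _ => 1
  | p + 1, i =>
    if h : p < P then
      weight hT e ε b ρ p i *
        (1 + ε) ^ (click ρ i (e.round hT ⟨p, h⟩ i) * b i /
          Finset.univ.sup' Finset.univ_nonempty b)
    else weight hT e ε b ρ p i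

/-- The distribution over the agents used in an exploitation round `t`: proportional to the
weights after the phases that precede the one of `t`. -/
noncomputable def dist [NeZero k] (hT : P * Q ≤ T) (e : Exploration k P Q) (ε : ℝ)
    (b : Fin k → ℝ) (ρ : Realization k T) (t : Fin T) (i : Fin k) : ℝ :=
  e.weight hT ε b ρ (t / Q) i / ∑ j, e.weight hT ε b ρ (t / Q) j

end Exploration

/-- The first element of a finite set of agents (the agent `0` if the set is empty). -/
def firstAgent {k : ℕ} [NeZero k] (s : Finset (Fin k)) : Fin k :=
  if h : s.Nonempty then s.min' h else 0

open Classical in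
/-- Sampling from a distribution `γ` on the agents with a uniform random `u ∈ [0, 1]`: the first
agent `i` with `u < γ 0 + ⋯ + γ i`. -/
noncomputable def sample {k : ℕ} [NeZero k] (γ : Fin k → ℝ) (u : ℝ) : Fin k :=
  firstAgent (Finset.univ.filter fun i => u < ∑ j ∈ Finset.Iic i, γ j)

theorem measurable_sample {k : ℕ} [NeZero k] (γ : Fin k → ℝ) : Measurable (sample γ) := by
  classical
  have key : ∀ s : Finset (Fin k), MeasurableSet
      {u : ℝ | (Finset.univ.filter fun i => u < ∑ j ∈ Finset.Iic i, γ j) = s} := by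
    intro s
    have : {u : ℝ | (Finset.univ.filter fun i => u < ∑ j ∈ Finset.Iic i, γ j) = s} =
        ⋂ i : Fin k, if i ∈ s then Set.Iio (∑ j ∈ Finset.Iic i, γ j)
          else Set.Ici (∑ j ∈ Finset.Iic i, γ j) := by
      ext u
      simp only [Set.mem_ofPred_eq, Set.mem_iInter, Finset.ext_iff, Finset.mem_filter,
        Finset.mem_univ, true_and]
      refine forall_congr' fun i => ?_
      by_cases hi : i ∈ s <;> simp [hi]
    rw [this]
    refine MeasurableSet.iInter fun i => ?_
    split_ifs
    · exact measurableSet_Iio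
    · exact measurableSet_Ici
  refine measurable_to_countable' fun i => ?_
  have : sample γ ⁻¹' {i} = ⋃ s ∈ {s : Finset (Fin k) | firstAgent s = i},
      {u : ℝ | (Finset.univ.filter fun i => u < ∑ j ∈ Finset.Iic i, γ j) = s} := by
    ext u
    simp [sample]
  rw [this]
  exact MeasurableSet.biUnion (Set.to_countable _) fun s _ => key s

open Classical in
/-- The agent that PSim plays at round `t`: the assigned agent if `t` is an exploration round,
and otherwise an agent drawn from the current distribution by means of `u t`.  If `P * Q < T`,
the remaining rounds at the end are exploitation rounds. -/
noncomputable def psimAlloc {k P Q T : ℕ} [NeZero k] (hT : P * Q ≤ T) (ε : ℝ)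
    (e : Exploration k P Q) (u : Fin T → unitInterval) (b : Fin k → ℝ) (ρ : Realization k T)
    (t : Fin T) : Fin k :=
  if h : ∃ i, ∃ p, e.round hT p i = t then h.choose else sample (e.dist hT ε b ρ t) (u t)

theorem Exploration.round_inj {k P Q T : ℕ} (hT : P * Q ≤ T) (e : Exploration k P Q)
    {p p' : Fin P} {i i' : Fin k} (h : e.round hT p i = e.round hT p' i') : i = i' := by
  have h0 : (p : ℕ) * Q + e p i = p' * Q + e p' i' := congrArg Fin.val h
  have h1 := (e p i).isLt
  have h2 := (e p' i').isLt
  have hQ : 0 < Q := by omega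
  have hp : (p : ℕ) = p' := by
    have := congrArg (· / Q) h0
    simpa [mul_comm _ Q, Nat.mul_add_div hQ, Nat.div_eq_of_lt h1, Nat.div_eq_of_lt h2] using this
  have hp' : p = p' := Fin.ext hp
  subst hp'
  exact (e p).injective (Fin.ext (by omega))

theorem psimAlloc_round {k P Q T : ℕ} [NeZero k] (hT : P * Q ≤ T) (ε : ℝ)
    (e : Exploration k P Q) (u : Fin T → unitInterval) (b : Fin k → ℝ) (ρ : Realization k T)
    (p : Fin P) (i : Fin k) : psimAlloc hT ε e u b ρ (e.round hT p i) = i := by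
  have h : ∃ i', ∃ p', e.round hT p' i' = e.round hT p i := ⟨i, p, rfl⟩
  rw [psimAlloc, dif_pos h]
  obtain ⟨p', hp'⟩ := h.choose_spec
  exact e.round_inj hT hp'

theorem Exploration.weight_congr {k P Q T : ℕ} [NeZero k] (hT : P * Q ≤ T)
    (e : Exploration k P Q) (ε : ℝ) (b : Fin k → ℝ) (ρ ρ' : Realization k T) (m : ℕ)
    (h : ∀ (p : Fin P) (i : Fin k), (p : ℕ) < m →
      ρ i (e.round hT p i) = ρ' i (e.round hT p i)) :
    ∀ i, e.weight hT ε b ρ m i = e.weight hT ε b ρ' m i := by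
  induction m with
  | zero => intro i; rfl
  | succ m ih =>
    intro i
    have ih' := ih (fun p i hp => h p i (by omega)) i
    by_cases hm : m < P
    · simp only [weight, hm, dite_true, ih', click, h ⟨m, hm⟩ i (Nat.lt_succ_self m)]
    · simp only [weight, hm, dite_false, ih']

theorem psimAlloc_online {k P Q T : ℕ} [NeZero k] (hT : P * Q ≤ T) (ε : ℝ)
    (e : Exploration k P Q) (u : Fin T → unitInterval) (b : Fin k → ℝ) (ρ ρ' : Realization k T)
    (t : Fin T)
    (h : ∀ s, s < t → ρ (psimAlloc hT ε e u b ρ s) s = ρ' (psimAlloc hT ε e u b ρ s) s) :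
    psimAlloc hT ε e u b ρ t = psimAlloc hT ε e u b ρ' t := by
  have hw := e.weight_congr hT ε b ρ ρ' (t / Q) (by
    intro p i hp
    have hlt : e.round hT p i < t := by
      have h1 := (e p i).isLt
      have h2 : (p.val + 1) * Q ≤ (t / Q) * Q := Nat.mul_le_mul_right Q hp
      have h3 := Nat.div_mul_le_self (t : ℕ) Q
      have h4 : ((e.round hT p i : Fin T) : ℕ) = p * Q + e p i := rfl
      rw [Nat.add_mul, one_mul] at h2
      exact Fin.lt_def.2 (by omega)
    have := h _ hlt
    rwa [psimAlloc_round] at this)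
  have hd : e.dist hT ε b ρ t = e.dist hT ε b ρ' t := by
    funext i
    simp only [Exploration.dist, hw]
  simp only [psimAlloc, hd]

theorem measurable_psimAlloc {k P Q T : ℕ} [NeZero k] (hT : P * Q ≤ T) (ε : ℝ)
    (b : Fin k → ℝ) (ρ : Realization k T) (t : Fin T) :
    Measurable fun ω : Exploration k P Q × (Fin T → unitInterval) =>
      psimAlloc hT ε ω.1 ω.2 b ρ t := by
  refine measurable_from_prod_countable_right fun e => ?_
  by_cases h : ∃ i, ∃ p, e.round hT p i = t
  · have h1 : (fun u => psimAlloc hT ε e u b ρ t) = fun _ => h.choose := by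
      funext u
      exact dif_pos h
    exact h1 ▸ measurable_const
  · have h1 : (fun u => psimAlloc hT ε e u b ρ t) = fun u => sample (e.dist hT ε b ρ t) (u t) := by
      funext u
      exact dif_neg h
    exact h1 ▸ (measurable_sample _).comp (measurable_subtype_coe.comp (measurable_pi_apply t))

/-- PSim with `P` phases of `⌊T / P⌋` rounds each and with parameter `ε`.  The random seed
consists of a uniformly random choice of the exploration rounds and, independently, one uniform
random number in `[0, 1]` for each round. -/
noncomputable def psim (k T P : ℕ) [NeZero k] (ε : ℝ) (hP : P * k ≤ T) : AllocationRule k T :=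
  haveI hT : P * (T / P) ≤ T := Nat.mul_div_le T P
  haveI : Nonempty (Exploration k P (T / P)) :=
    Exploration.nonempty_of_le fun h => (Nat.le_div_iff_mul_le h).2 (by rwa [mul_comm])
  { Seed := Exploration k P (T / P) × (Fin T → unitInterval)
    law := (PMF.uniformOfFintype (Exploration k P (T / P))).toMeasure.prod volume
    alloc := fun ω => psimAlloc hT ε ω.1 ω.2
    measurable_alloc := measurable_psimAlloc hT ε
    online := fun ω => psimAlloc_online hT ε ω.1 ω.2 }

/-- The number of phases `(log k)^(1/3) * (T / k)^(2/3)`, rounded down, and at most `⌊T / k⌋` so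
that every phase has room for `k` exploration rounds. -/
noncomputable def psimPhases (k T : ℕ) : ℕ :=
  min ⌊Real.log k ^ (1 / 3 : ℝ) * ((T : ℝ) / k) ^ (2 / 3 : ℝ)⌋₊ (T / k)

/-- The parameter `ε = (k log k / T)^(1/3)`. -/
noncomputable def psimRate (k T : ℕ) : ℝ := (k * Real.log k / T) ^ (1 / 3 : ℝ)

/-- PSim with the above choice of the parameters. -/
noncomputable def tunedPSim (k T : ℕ) [NeZero k] : AllocationRule k T :=
  psim k T (psimPhases k T) (psimRate k T)
    ((Nat.mul_le_mul_right k (min_le_right _ _)).trans (Nat.div_mul_le_self T k))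

/-! ## Sampling from a distribution -/

/-! The weights of PSim are updated only from exploration rounds, whose allocation ignores the bids,
so once the exploration rounds are fixed the rounds decouple.

Truthfulness. Raising one's own bid raises one's ratio to the largest bid and lowers everybody
else's, so the exploitation probability π of an agent is nondecreasing in her bid
(`Exploration.dist_mono`). Myerson's payment for a click, b π(b) - ∫₀ᵇ π, is charged in expectation
by pricing a click won in an exploitation round at b - (∫₀ᵇ π)/π(b). Monotonicity places this price
between 0 and b for every seed, and makes truthful bidding optimal in each round
(`sum_condProb_mul_utility_le`). The price is computable from observed clicks, because π at every
counterfactual bid depends only on exploration rounds.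

Regret. Gains are measured relative to the largest bid, so they lie in [0, 1]. On the explored gains
PSim runs multiplicative weights with full information over P phases, losing at most εP + (log k)/ε
(`multiplicative_weights`). An agent's exploration round is uniform in its phase and independent of
the weights used there, so multiplying by Q transfers this bound to all rounds of the phases in
expectation (`Exploration.sum_mul_apply`). Exploration costs at most Pk more and the leftover rounds
T - PQ. With the chosen parameters each piece is of order (k log k)^(1/3) T^(2/3); small T and k = 1
are handled by trivial bounds. -/

theorem sample_eq_iff {k : ℕ} [NeZero k] {γ : Fin k → ℝ} (h0 : ∀ i, 0 ≤ γ i) (h1 : ∑ i, γ i = 1)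
    {u : ℝ} (hu0 : 0 ≤ u) (hu1 : u < 1) (i : Fin k) :
    sample γ u = i ↔ u ∈ Set.Ico (∑ j ∈ Finset.Iio i, γ j) (∑ j ∈ Finset.Iic i, γ j) := by
  classical
  have hne : (Finset.univ.filter fun i : Fin k => u < ∑ j ∈ Finset.Iic i, γ j).Nonempty := by
    -- The last agent always qualifies: her partial sum is the total 1 > u.
    refine ⟨⊤, ?_⟩
    simp [h1, hu1]
  have hS : sample γ u = (Finset.univ.filter fun i : Fin k =>
      u < ∑ j ∈ Finset.Iic i, γ j).min' hne := by
    unfold sample firstAgent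
    convert dif_pos hne
  rw [hS, Finset.min'_eq_iff]
  simp only [Finset.mem_filter, Finset.mem_univ, true_and, Set.mem_Ico]
  constructor
  · rintro ⟨hi, hmin⟩
    refine ⟨?_, hi⟩
    rcases (Finset.Iio i).eq_empty_or_nonempty with he | he
    · simpa [he] using hu0
    · by_contra! hlt
      have hm := Finset.max'_mem _ he
      have hsub : Finset.Iio i ⊆ Finset.Iic ((Finset.Iio i).max' he) := fun j hj =>
        Finset.mem_Iic.2 (Finset.le_max' _ _ hj)
      have := hmin _ (hlt.trans_le (Finset.sum_le_sum_of_subset_of_nonneg hsub fun j _ _ => h0 j))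
      exact absurd (Finset.mem_Iio.1 hm) (not_lt.2 this)
  · rintro ⟨hlo, hi⟩
    refine ⟨hi, fun j hj => ?_⟩
    by_contra! hlt
    have hsub : Finset.Iic j ⊆ Finset.Iio i := fun l hl =>
      Finset.mem_Iio.2 ((Finset.mem_Iic.1 hl).trans_lt hlt)
    have := Finset.sum_le_sum_of_subset_of_nonneg hsub fun j _ _ => h0 j
    linarith

/-- Up to a null set, agent i is sampled on a half-open interval of length `γ i`. The point u = 1
has to be excluded, since there no partial sum exceeds u and the default agent is returned. -/
theorem volume_real_sample_eq {k : ℕ} [NeZero k] {γ : Fin k → ℝ} (h0 : ∀ i, 0 ≤ γ i)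
    (h1 : ∑ i, γ i = 1) (i : Fin k) :
    (volume : Measure unitInterval).real {u | sample γ u = i} = γ i := by
  have hsucc : ∑ j ∈ Finset.Iic i, γ j = γ i + ∑ j ∈ Finset.Iio i, γ j := by
    rw [← Finset.Iio_insert, Finset.sum_insert (by simp)]
  have hlo : 0 ≤ ∑ j ∈ Finset.Iio i, γ j := Finset.sum_nonneg fun j _ => h0 j
  have hhi : ∑ j ∈ Finset.Iic i, γ j ≤ 1 :=
    h1 ▸ Finset.sum_le_sum_of_subset_of_nonneg (Finset.subset_univ _) fun j _ _ => h0 j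
  have hae : {u : unitInterval | sample γ u = i} =ᵐ[volume]
      ((↑) : unitInterval → ℝ) ⁻¹'
        Set.Ico (∑ j ∈ Finset.Iio i, γ j) (∑ j ∈ Finset.Iic i, γ j) := by
    have hne : ∀ᵐ u : unitInterval, u ≠ 1 := by
      simp [ae_iff]
    filter_upwards [hne] with u hu
    have hu1 : (u : ℝ) < 1 := lt_of_le_of_ne u.2.2 fun h => hu (Subtype.ext h)
    exact propext (sample_eq_iff h0 h1 u.2.1 hu1 i)
  rw [measureReal_congr hae, measureReal_def,
    unitInterval.measurePreserving_coe.measure_preimage measurableSet_Ico.nullMeasurableSet,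
    Measure.restrict_apply measurableSet_Ico,
    Set.inter_eq_left.2 (Set.Ico_subset_Icc_self.trans (Set.Icc_subset_Icc hlo hhi)),
    Real.volume_Ico, hsucc, add_sub_cancel_right, ENNReal.toReal_ofReal (h0 i)]

/-! ## Weights and the exploitation distribution -/

/-- The largest bid. -/
noncomputable abbrev maxBid {k : ℕ} [NeZero k] (b : Fin k → ℝ) : ℝ :=
  Finset.univ.sup' Finset.univ_nonempty b

theorem le_maxBid {k : ℕ} [NeZero k] (b : Fin k → ℝ) (i : Fin k) : b i ≤ maxBid b :=
  Finset.le_sup' b (Finset.mem_univ i)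

theorem maxBid_nonneg {k : ℕ} [NeZero k] {b : Fin k → ℝ} (hb : ∀ i, 0 ≤ b i) : 0 ≤ maxBid b :=
  (hb 0).trans (le_maxBid b 0)

theorem click_nonneg {k T : ℕ} (ρ : Realization k T) (i : Fin k) (t : Fin T) : 0 ≤ click ρ i t := by
  unfold click; split_ifs <;> norm_num

theorem click_le_one {k T : ℕ} (ρ : Realization k T) (i : Fin k) (t : Fin T) :
    click ρ i t ≤ 1 := by
  unfold click; split_ifs <;> norm_num

theorem update_nonneg {k : ℕ} {b : Fin k → ℝ} (hb : ∀ j, 0 ≤ b j) {x : ℝ} (hx : 0 ≤ x)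
    (i j : Fin k) : 0 ≤ Function.update b i x j := by
  by_cases hj : j = i
  · subst hj; simpa
  · simpa [hj] using hb j

section BidMonotone

variable {k : ℕ} [NeZero k] {b : Fin k → ℝ} (hb : ∀ j, 0 ≤ b j) {i : Fin k} {x y : ℝ}
  (hx : 0 ≤ x) (hxy : x ≤ y)

include hxy in
theorem maxBid_update_mono : maxBid (Function.update b i x) ≤ maxBid (Function.update b i y) := by
  refine Finset.sup'_le _ _ fun j _ => le_trans ?_ (le_maxBid _ j)
  by_cases hj : j = i
  · subst hj; simpa
  · simp [hj]

include hb hx hxy in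
theorem relative_bid_other_anti {j : Fin k} (hj : j ≠ i) :
    b j / maxBid (Function.update b i y) ≤ b j / maxBid (Function.update b i x) := by
  have hle : b j ≤ maxBid (Function.update b i x) := by
    simpa [hj] using le_maxBid (Function.update b i x) j
  rcases (maxBid_nonneg (update_nonneg hb hx i)).eq_or_lt with
    h0 | h0
  · rw [le_antisymm (hle.trans h0.ge) (hb j)]; simp
  · exact div_le_div_of_nonneg_left (hb j) h0 (maxBid_update_mono hxy)

include hx hxy in
-- Either agent i attains the maximum at the bid y, and her ratio is then 1, or somebody else does;
-- in the latter case the maximum at x is no smaller and only the numerator grows.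
theorem relative_bid_self_mono :
    x / maxBid (Function.update b i x) ≤ y / maxBid (Function.update b i y) := by
  have hxm : x ≤ maxBid (Function.update b i x) := by
    simpa using le_maxBid (Function.update b i x) i
  have hy : 0 ≤ y := hx.trans hxy
  have hym : y ≤ maxBid (Function.update b i y) := by
    simpa using le_maxBid (Function.update b i y) i
  obtain ⟨j, -, hj⟩ := Finset.exists_mem_eq_sup' Finset.univ_nonempty (Function.update b i y)
  rcases hx.eq_or_lt with rfl | hx0
  · simpa using div_nonneg hy (hy.trans hym)
  have hMx : 0 < maxBid (Function.update b i x) := hx0.trans_le hxm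
  have hMy : 0 < maxBid (Function.update b i y) := hx0.trans_le (hxy.trans hym)
  by_cases hji : j = i
  · subst hji
    have : maxBid (Function.update b j y) = y := by simpa using hj
    rw [this, div_self (hx0.trans_le hxy).ne']
    exact div_le_one_of_le₀ hxm hMx.le
  · have : maxBid (Function.update b i y) = b j := by simpa [hji] using hj
    have hle : maxBid (Function.update b i y) ≤ maxBid (Function.update b i x) := by
      rw [this]; simpa [hji] using le_maxBid (Function.update b i x) j
    exact (div_le_div_of_nonneg_right hxy hMx.le).trans (div_le_div_of_nonneg_left hy hMy hle)

end BidMonotone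

namespace Exploration

variable {k P Q T : ℕ} [NeZero k] (hT : P * Q ≤ T) (e : Exploration k P Q) {ε : ℝ} (hε : 0 ≤ ε)
  (b : Fin k → ℝ) (ρ : Realization k T)

include hε

theorem weight_pos (m : ℕ) (i : Fin k) : 0 < e.weight hT ε b ρ m i := by
  induction m with
  | zero => simp [weight]
  | succ m ih =>
    unfold weight
    split_ifs
    · positivity
    · exact ih

theorem sum_weight_pos (m : ℕ) : 0 < ∑ j, e.weight hT ε b ρ m j :=
  Finset.sum_pos (fun j _ => e.weight_pos hT hε b ρ m j) Finset.univ_nonempty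

theorem dist_pos (t : Fin T) (i : Fin k) : 0 < e.dist hT ε b ρ t i :=
  div_pos (e.weight_pos hT hε b ρ _ i) (e.sum_weight_pos hT hε b ρ _)

theorem sum_dist (t : Fin T) : ∑ i, e.dist hT ε b ρ t i = 1 := by
  simp only [dist]
  rw [← Finset.sum_div, div_self (e.sum_weight_pos hT hε b ρ _).ne']

variable {b} {i : Fin k} {x y : ℝ}

theorem weight_self_mono (hx : 0 ≤ x) (hxy : x ≤ y) (m : ℕ) :
    e.weight hT ε (Function.update b i x) ρ m i ≤ e.weight hT ε (Function.update b i y) ρ m i := by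
  induction m with
  | zero => simp [weight]
  | succ m ih =>
    unfold weight
    split_ifs with h
    · refine mul_le_mul ih ?_ (by positivity) (e.weight_pos hT hε _ ρ m i).le
      refine Real.rpow_le_rpow_of_exponent_le (by linarith) ?_
      rw [mul_div_assoc, mul_div_assoc, Function.update_self, Function.update_self]
      exact mul_le_mul_of_nonneg_left (relative_bid_self_mono hx hxy) (click_nonneg _ _ _)
    · exact ih

theorem weight_other_anti (hb : ∀ j, 0 ≤ b j) (hx : 0 ≤ x) (hxy : x ≤ y) {j : Fin k} (hj : j ≠ i)
    (m : ℕ) :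
    e.weight hT ε (Function.update b i y) ρ m j ≤ e.weight hT ε (Function.update b i x) ρ m j := by
  induction m with
  | zero => simp [weight]
  | succ m ih =>
    unfold weight
    split_ifs with h
    · refine mul_le_mul ih ?_ (by positivity) (e.weight_pos hT hε _ ρ m j).le
      refine Real.rpow_le_rpow_of_exponent_le (by linarith) ?_
      rw [mul_div_assoc, mul_div_assoc, Function.update_of_ne hj, Function.update_of_ne hj]
      exact mul_le_mul_of_nonneg_left (relative_bid_other_anti hb hx hxy hj) (click_nonneg _ _ _)
    · exact ih

/-- An agent is selected with a larger probability in an exploitation round if she bids more. -/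
theorem dist_mono (hb : ∀ j, 0 ≤ b j) (hx : 0 ≤ x) (hxy : x ≤ y) (t : Fin T) :
    e.dist hT ε (Function.update b i x) ρ t i ≤ e.dist hT ε (Function.update b i y) ρ t i := by
  unfold dist
  rw [div_le_div_iff₀ (e.sum_weight_pos hT hε _ ρ _) (e.sum_weight_pos hT hε _ ρ _),
    Finset.mul_sum, Finset.mul_sum]
  -- After cross-multiplication the inequality holds term by term: w_i grows with the bid of i and
  -- every other w_j shrinks.
  refine Finset.sum_le_sum fun j _ => ?_
  by_cases hj : j = i
  · subst hj; rw [mul_comm]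
  · exact mul_le_mul (e.weight_self_mono hT hε ρ hx hxy _)
      (e.weight_other_anti hT hε ρ hb hx hxy hj _) (e.weight_pos hT hε _ ρ _ j).le
      (e.weight_pos hT hε _ ρ _ i).le

end Exploration

/-! ## The distribution of the allocation of PSim -/

namespace Exploration

variable {k P Q T : ℕ} (hT : P * Q ≤ T) (e : Exploration k P Q)

/-- `t` is an exploration round. -/
def IsExplored (t : Fin T) : Prop := ∃ i, ∃ p, e.round hT p i = t

variable [NeZero k] (ε : ℝ) (b : Fin k → ℝ) (ρ : Realization k T)

/-- The probability that agent `i` is played at round `t`, given the exploration rounds. -/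
noncomputable def condProb (t : Fin T) (i : Fin k) : ℝ :=
  (volume : Measure (Fin T → unitInterval)).real {u | psimAlloc hT ε e u b ρ t = i}

theorem condProb_nonneg (t : Fin T) (i : Fin k) : 0 ≤ e.condProb hT ε b ρ t i :=
  measureReal_nonneg

variable {hT e} in
theorem psimAlloc_congr_of_isExplored {t : Fin T} (h : e.IsExplored hT t)
    (u u' : Fin T → unitInterval) (b b' : Fin k → ℝ) (ρ ρ' : Realization k T) :
    psimAlloc hT ε e u b ρ t = psimAlloc hT ε e u' b' ρ' t := by
  obtain ⟨i, p, rfl⟩ := h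
  rw [psimAlloc_round, psimAlloc_round]

variable {hT e} in
theorem condProb_congr_of_isExplored {t : Fin T} (h : e.IsExplored hT t) (b' : Fin k → ℝ)
    (i : Fin k) : e.condProb hT ε b ρ t i = e.condProb hT ε b' ρ t i := by
  have : ∀ u, psimAlloc hT ε e u b ρ t = psimAlloc hT ε e u b' ρ t := fun u =>
    psimAlloc_congr_of_isExplored ε h u u b b' ρ ρ
  simp only [condProb, this]

variable {hT e ε} in
theorem condProb_of_not_isExplored (hε : 0 ≤ ε) {t : Fin T} (h : ¬ e.IsExplored hT t)
    (i : Fin k) : e.condProb hT ε b ρ t i = e.dist hT ε b ρ t i := by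
  have h1 : {u | psimAlloc hT ε e u b ρ t = i} =
      (fun u : Fin T → unitInterval => u t) ⁻¹' {v | sample (e.dist hT ε b ρ t) v = i} := by
    ext u
    have : psimAlloc hT ε e u b ρ t = sample (e.dist hT ε b ρ t) (u t) := dif_neg h
    simp [this]
  have hmeas : MeasurableSet {v : unitInterval | sample (e.dist hT ε b ρ t) v = i} :=
    ((measurable_sample _).comp measurable_subtype_coe) (measurableSet_singleton i)
  have hev : MeasurePreserving (fun u : Fin T → unitInterval => u t) volume volume :=
    measurePreserving_eval (fun _ : Fin T => (volume : Measure unitInterval)) t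
  rw [condProb, h1, measureReal_def, hev.measure_preimage hmeas.nullMeasurableSet, ← measureReal_def,
    volume_real_sample_eq (fun j => (e.dist_pos hT hε b ρ t j).le) (e.sum_dist hT hε b ρ t)]

end Exploration

section Outcome

variable {k P Q T : ℕ} [NeZero k] (hT : P * Q ≤ T) (ε : ℝ) (b : Fin k → ℝ) (ρ : Realization k T)

/-- The exploration rounds together with the agents that are played. -/
noncomputable def psimOutcome (ω : Exploration k P Q × (Fin T → unitInterval)) :
    Exploration k P Q × (Fin T → Fin k) :=
  (ω.1, fun t => psimAlloc hT ε ω.1 ω.2 b ρ t)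

theorem measurable_psimOutcome : Measurable (psimOutcome (P := P) (Q := Q) hT ε b ρ) :=
  measurable_fst.prodMk (measurable_pi_lambda _ fun t => measurable_psimAlloc hT ε b ρ t)

/-- The outcome takes finitely many values, so any function of it is measurable and integrable;
payments depend on the seed only through it. -/
theorem measurable_comp_psimOutcome (F : Exploration k P Q × (Fin T → Fin k) → ℝ) :
    Measurable fun ω => F (psimOutcome hT ε b ρ ω) :=
  (measurable_of_countable F).comp (measurable_psimOutcome hT ε b ρ)

theorem integrable_comp_psimOutcome (μ : Measure (Exploration k P Q × (Fin T → unitInterval)))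
    [IsFiniteMeasure μ] (F : Exploration k P Q × (Fin T → Fin k) → ℝ) :
    Integrable (fun ω => F (psimOutcome hT ε b ρ ω)) μ :=
  (Integrable.of_finite (μ := μ.map (psimOutcome hT ε b ρ)) (f := F)).comp_measurable
    (measurable_psimOutcome hT ε b ρ)

theorem integral_comp_psimAlloc (e : Exploration k P Q) (t : Fin T) (F : Fin k → ℝ) :
    ∫ u, F (psimAlloc hT ε e u b ρ t) = ∑ j, e.condProb hT ε b ρ t j * F j := by
  have hm : Measurable fun u => psimAlloc hT ε e u b ρ t :=
    (measurable_psimAlloc hT ε b ρ t).comp measurable_prodMk_left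
  rw [← integral_map (φ := fun u => psimAlloc hT ε e u b ρ t) hm.aemeasurable
    (measurable_of_countable F).aestronglyMeasurable, integral_fintype Integrable.of_finite]
  refine Finset.sum_congr rfl fun j _ => ?_
  rw [map_measureReal_apply hm (measurableSet_singleton j), smul_eq_mul]
  rfl

/-- The expectation over the seed of a sum over the rounds. -/
theorem integral_sum_psimAlloc [Nonempty (Exploration k P Q)]
    (F : Exploration k P Q → Fin T → Fin k → ℝ) :
    ∫ ω, ∑ t, F ω.1 t (psimAlloc hT ε ω.1 ω.2 b ρ t)
        ∂((PMF.uniformOfFintype (Exploration k P Q)).toMeasure.prod volume) =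
      (Fintype.card (Exploration k P Q) : ℝ)⁻¹ *
        ∑ e, ∑ t, ∑ j, e.condProb hT ε b ρ t j * F e t j := by
  have hint : Integrable (fun ω => ∑ t, F ω.1 t (psimAlloc hT ε ω.1 ω.2 b ρ t))
      ((PMF.uniformOfFintype (Exploration k P Q)).toMeasure.prod volume) :=
    integrable_comp_psimOutcome hT ε b ρ _ fun o => ∑ t, F o.1 t (o.2 t)
  rw [integral_prod _ hint, PMF.integral_eq_sum, Finset.mul_sum]
  refine Finset.sum_congr rfl fun e _ => ?_
  rw [PMF.uniformOfFintype_apply, ENNReal.toReal_inv, ENNReal.toReal_natCast, smul_eq_mul]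
  congr 1
  rw [integral_finsetSum]
  · exact Finset.sum_congr rfl fun t _ => integral_comp_psimAlloc hT ε b ρ e t (F e t)
  · intro t _
    have hm : Measurable fun u => psimAlloc hT ε e u b ρ t :=
      (measurable_psimAlloc hT ε b ρ t).comp measurable_prodMk_left
    exact (Integrable.of_finite (μ := volume.map fun u => psimAlloc hT ε e u b ρ t)
      (f := F e t)).comp_measurable hm

end Outcome

/-! ## The payment rule -/

section Payment

variable {k P Q T : ℕ} [NeZero k] (hT : P * Q ≤ T) (ε : ℝ)

/-- The integral of the selection probability of agent `i` over her bids up to `b i`. -/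
noncomputable def distIntegral (e : Exploration k P Q) (b : Fin k → ℝ) (ρ : Realization k T)
    (t : Fin T) (i : Fin k) : ℝ :=
  ∫ x in (0 : ℝ)..b i, e.dist hT ε (Function.update b i x) ρ t i

open Classical in
/-- The payment of agent `i` for round `t` if agent `a` is played: exploration is free, and a click
in an exploitation round has the price that yields Myerson's payment in expectation. -/
noncomputable def roundPay (e : Exploration k P Q) (b : Fin k → ℝ) (ρ : Realization k T)
    (i : Fin k) (t : Fin T) (a : Fin k) : ℝ :=
  if e.IsExplored hT t then 0
  else if a = i then
    click ρ i t * (b i - distIntegral hT ε e b ρ t i / e.dist hT ε b ρ t i)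
  else 0

variable {ε} (hε : 0 ≤ ε) (e : Exploration k P Q) {b : Fin k → ℝ} (hb : ∀ j, 0 ≤ b j)
  (ρ : Realization k T) (t : Fin T) (i : Fin k)

include hε hb

theorem intervalIntegrable_dist {x y : ℝ} (hx : 0 ≤ x) (hy : 0 ≤ y) :
    IntervalIntegrable (fun z => e.dist hT ε (Function.update b i z) ρ t i) volume x y := by
  refine MonotoneOn.intervalIntegrable fun z hz w _ hzw => ?_
  exact e.dist_mono hT hε ρ hb ((le_inf hx hy).trans hz.1) hzw t

theorem distIntegral_nonneg : 0 ≤ distIntegral hT ε e b ρ t i :=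
  intervalIntegral.integral_nonneg (hb i) fun _ _ => (e.dist_pos hT hε _ ρ t i).le

/-- The integral of the nondecreasing selection probability lies above its tangents. -/
theorem add_mul_dist_le_distIntegral {x : ℝ} (hx : 0 ≤ x) :
    distIntegral hT ε e b ρ t i + (x - b i) * e.dist hT ε b ρ t i ≤
      distIntegral hT ε e (Function.update b i x) ρ t i := by
  have hadd := intervalIntegral.integral_add_adjacent_intervals
    (intervalIntegrable_dist hT hε e hb ρ t i le_rfl (hb i))
    (intervalIntegrable_dist hT hε e hb ρ t i (hb i) hx)
  simp only [distIntegral, Function.update_idem, Function.update_self]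
  rw [← hadd]
  have hbi : e.dist hT ε b ρ t i = e.dist hT ε (Function.update b i (b i)) ρ t i := by
    rw [Function.update_eq_self]
  have hconst : ∫ _ in b i..x, e.dist hT ε b ρ t i = (x - b i) * e.dist hT ε b ρ t i := by
    simp
  -- By monotonicity the integrand is at least its value at `b i` to the right of `b i` and at most
  -- that value to the left.
  have key : ∫ _ in b i..x, e.dist hT ε b ρ t i ≤
      ∫ z in b i..x, e.dist hT ε (Function.update b i z) ρ t i := by
    rcases le_total (b i) x with h | h
    · refine intervalIntegral.integral_mono_on h (by simp)
        (intervalIntegrable_dist hT hε e hb ρ t i (hb i) hx) fun z hz => ?_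
      rw [hbi]
      exact e.dist_mono hT hε ρ hb (hb i) hz.1 t
    · rw [intervalIntegral.integral_symm x, intervalIntegral.integral_symm x, neg_le_neg_iff]
      refine intervalIntegral.integral_mono_on h
        (intervalIntegrable_dist hT hε e hb ρ t i hx (hb i)) (by simp) fun z hz => ?_
      rw [hbi]
      exact e.dist_mono hT hε ρ hb (hx.trans hz.1) hz.2 t
  linarith

/-- This is the tangent inequality at the bid 0, where the integral vanishes. -/
theorem distIntegral_le : distIntegral hT ε e b ρ t i ≤ b i * e.dist hT ε b ρ t i := by
  have h := add_mul_dist_le_distIntegral hT hε e hb ρ t i le_rfl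
  simp only [distIntegral, Function.update_self, intervalIntegral.integral_same] at h ⊢
  linarith

theorem roundPay_nonneg (a : Fin k) : 0 ≤ roundPay hT ε e b ρ i t a := by
  unfold roundPay
  split_ifs
  · exact le_rfl
  · refine mul_nonneg (click_nonneg _ _ _) (sub_nonneg.2 ?_)
    rw [div_le_iff₀ (e.dist_pos hT hε b ρ t i)]
    exact distIntegral_le hT hε e hb ρ t i
  · exact le_rfl

theorem roundPay_le (a : Fin k) :
    roundPay hT ε e b ρ i t a ≤ b i * if a = i then click ρ i t else 0 := by
  have hc := click_nonneg ρ i t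
  unfold roundPay
  split_ifs
  · exact mul_nonneg (hb i) hc
  · simp
  · rw [mul_comm]
    refine mul_le_mul_of_nonneg_right (sub_le_self _ ?_) hc
    exact div_nonneg (distIntegral_nonneg hT hε e hb ρ t i) (e.dist_pos hT hε b ρ t i).le
  · simp

/-- Truthful bidding maximizes the expected utility from a single round, given the exploration
rounds. -/
theorem sum_condProb_mul_utility_le {x : ℝ} (hx : 0 ≤ x) :
    ∑ j, e.condProb hT ε b ρ t j *
        (x * (if j = i then click ρ i t else 0) - roundPay hT ε e b ρ i t j) ≤
      ∑ j, e.condProb hT ε (Function.update b i x) ρ t j *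
        (x * (if j = i then click ρ i t else 0) -
          roundPay hT ε e (Function.update b i x) ρ i t j) := by
  by_cases h : e.IsExplored hT t
  · simp only [roundPay, h, if_true]
    exact (Finset.sum_congr rfl fun j _ => by
      rw [e.condProb_congr_of_isExplored ε b ρ h (Function.update b i x) j]).le
  -- The selection probability cancels the denominator of the price. What remains is the tangent at
  -- `b' i` of the convex function `distIntegral`, evaluated at x; for the truthful bid it is the
  -- function value itself.
  · have key : ∀ b' : Fin k → ℝ, ∑ j, e.condProb hT ε b' ρ t j *
        (x * (if j = i then click ρ i t else 0) - roundPay hT ε e b' ρ i t j) =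
        click ρ i t * (distIntegral hT ε e b' ρ t i + (x - b' i) * e.dist hT ε b' ρ t i) := by
      intro b'
      have hpos := e.dist_pos hT hε b' ρ t i
      rw [Finset.sum_eq_single i (fun j _ hj => by simp [roundPay, hj]) (by simp)]
      simp only [roundPay, h, if_false, if_true, e.condProb_of_not_isExplored b' ρ hε h]
      field_simp
      ring
    rw [key, key]
    refine mul_le_mul_of_nonneg_left ?_ (click_nonneg _ _ _)
    simpa using add_mul_dist_le_distIntegral hT hε e hb ρ t i hx

end Payment

section PaymentRule

variable {k T P : ℕ} [NeZero k] {ε : ℝ} {hP : P * k ≤ T}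

variable (k T P ε hP) in
/-- The payment rule that charges for each round the price `roundPay`. -/
noncomputable def psimPayment : PaymentRule (psim k T P ε hP) where
  pay ω b ρ i := ∑ t, roundPay (Nat.mul_div_le T P) ε ω.1 b ρ i t
    (psimAlloc (Nat.mul_div_le T P) ε ω.1 ω.2 b ρ t)
  measurable_pay b ρ i := measurable_comp_psimOutcome (Nat.mul_div_le T P) ε b ρ
    fun o => ∑ t, roundPay (Nat.mul_div_le T P) ε o.1 b ρ i t (o.2 t)
  observed := by
    rintro ⟨e, u⟩ b ρ ρ' h
    have hT := Nat.mul_div_le T P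
    change ∀ t, ρ (psimAlloc hT ε e u b ρ t) t = ρ' (psimAlloc hT ε e u b ρ t) t at h
    -- Even at counterfactual bids the distribution uses only the bits of exploration rounds, where
    -- the assigned agent is always played and her bit is observed.
    have hd : ∀ b', e.dist hT ε b' ρ = e.dist hT ε b' ρ' := by
      intro b'
      funext t i
      simp only [Exploration.dist]
      simp only [e.weight_congr hT ε b' ρ ρ' _ fun p j _ => by
        have := h (e.round hT p j); rwa [psimAlloc_round] at this]
    have ha : ∀ t, psimAlloc hT ε e u b ρ t = psimAlloc hT ε e u b ρ' t :=
      fun t => psimAlloc_online hT ε e u b ρ ρ' t fun s _ => h s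
    funext i
    refine Finset.sum_congr rfl fun t _ => ?_
    rw [← ha t]
    unfold roundPay
    split_ifs with h1 h2
    · rfl
    · have hc : click ρ i t = click ρ' i t := by
        have := h t
        rw [h2] at this
        simp only [click, this]
      simp only [distIntegral, hd, hc]
    · rfl

theorem psimPayment_pay (ω : (psim k T P ε hP).Seed) (b : Fin k → ℝ) (ρ : Realization k T)
    (i : Fin k) : (psimPayment k T P ε hP).pay ω b ρ i =
      ∑ t, roundPay (Nat.mul_div_le T P) ε ω.1 b ρ i t ((psim k T P ε hP).alloc ω b ρ t) :=
  rfl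

theorem psimPayment_isNormalized (hε : 0 ≤ ε) : (psimPayment k T P ε hP).IsNormalized := by
  intro ω b hb ρ i
  rw [psimPayment_pay]
  constructor
  · exact Finset.sum_nonneg fun t _ => roundPay_nonneg (Nat.mul_div_le T P) hε ω.1 hb ρ t i _
  · rw [AllocationRule.clicks, Finset.mul_sum]
    exact Finset.sum_le_sum fun t _ => roundPay_le (Nat.mul_div_le T P) hε ω.1 hb ρ t i _

theorem psimPayment_isWeaklyTruthful (hε : 0 ≤ ε) :
    (psimPayment k T P ε hP).IsWeaklyTruthful := by
  intro ρ i x hx b hb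
  have hT := Nat.mul_div_le T P
  have : Nonempty (Exploration k P (T / P)) :=
    Exploration.nonempty_of_le fun h => (Nat.le_div_iff_mul_le h).2 (by rwa [mul_comm])
  -- Utility is additive over rounds, so its expectation is an average over explorations of
  -- single-round terms, which can be compared one by one.
  have hu : ∀ b' : Fin k → ℝ, ∫ ω, (psimPayment k T P ε hP).utility ω x b' ρ i
      ∂(psim k T P ε hP).law = (Fintype.card (Exploration k P (T / P)) : ℝ)⁻¹ *
        ∑ e : Exploration k P (T / P), ∑ t, ∑ j, e.condProb hT ε b' ρ t j *
          (x * (if j = i then click ρ i t else 0) - roundPay hT ε e b' ρ i t j) := by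
    intro b'
    rw [← integral_sum_psimAlloc hT ε b' ρ fun e t j =>
      x * (if j = i then click ρ i t else 0) - roundPay hT ε e b' ρ i t j]
    refine integral_congr_ae (Filter.Eventually.of_forall fun ω => ?_)
    simp only [PaymentRule.utility, AllocationRule.clicks, Finset.mul_sum,
      Finset.sum_sub_distrib]
    rfl
  rw [hu, hu]
  refine mul_le_mul_of_nonneg_left ?_ (by positivity)
  exact Finset.sum_le_sum fun e _ => Finset.sum_le_sum fun t _ =>
    sum_condProb_mul_utility_le hT hε e hb ρ t i hx

theorem playProb_psim (b : Fin k → ℝ) (ρ : Realization k T) (t : Fin T) (i : Fin k) :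
    (psim k T P ε hP).playProb b ρ t i =
      (Fintype.card (Exploration k P (T / P)) : ℝ)⁻¹ *
        ∑ e : Exploration k P (T / P), e.condProb (Nat.mul_div_le T P) ε b ρ t i := by
  classical
  have hT := Nat.mul_div_le T P
  have : Nonempty (Exploration k P (T / P)) :=
    Exploration.nonempty_of_le fun h => (Nat.le_div_iff_mul_le h).2 (by rwa [mul_comm])
  have h1 := integral_sum_psimAlloc hT ε b ρ fun (_ : Exploration k P (T / P)) s j =>
    if s = t then if j = i then (1 : ℝ) else 0 else 0
  simp only [Finset.sum_ite_eq', Finset.mem_univ, if_true, mul_ite, mul_one, mul_zero,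
    Finset.sum_ite_irrel, Finset.sum_const_zero] at h1
  rw [← h1]
  have hs : MeasurableSet {ω | (psim k T P ε hP).alloc ω b ρ t = i} :=
    (psim k T P ε hP).measurable_alloc b ρ t (measurableSet_singleton i)
  rw [AllocationRule.playProb, ← integral_indicator_one hs]
  refine integral_congr_ae (Filter.Eventually.of_forall fun ω => ?_)
  simp only [Set.indicator_apply, Set.mem_ofPred_eq, Pi.one_apply]
  rfl

end PaymentRule

/-! ## Multiplicative weights -/

/-- The regret bound of the multiplicative weights algorithm. -/
theorem multiplicative_weights {k : ℕ} [NeZero k] {ε : ℝ} (hε : 0 ≤ ε) {x w : ℕ → Fin k → ℝ}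
    (hx0 : ∀ m j, 0 ≤ x m j) (hx1 : ∀ m j, x m j ≤ 1) (hw0 : ∀ j, w 0 j = 1)
    (hw : ∀ m j, w (m + 1) j = w m j * (1 + ε) ^ x m j) (n : ℕ) (i : Fin k) :
    Real.log (1 + ε) * ∑ m ∈ Finset.range n, x m i ≤
      Real.log k + ε * ∑ m ∈ Finset.range n, ∑ j, w m j / (∑ l, w m l) * x m j := by
  have hpos : ∀ m j, 0 < w m j := by
    intro m j
    induction m with
    | zero => simp [hw0]
    | succ m ih => rw [hw]; positivity
  have hW : ∀ m, 0 < ∑ l, w m l := fun m =>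
    Finset.sum_pos (fun j _ => hpos m j) Finset.univ_nonempty
  have hk : (0 : ℝ) < k := Nat.cast_pos.2 (NeZero.pos k)
  -- The total weight is the potential: each step multiplies it by at most 1 + ε·gain ≤ exp(ε·gain),
  -- where the gain is the expected one.
  have hupper : ∑ l, w n l ≤
      k * Real.exp (ε * ∑ m ∈ Finset.range n, ∑ j, w m j / (∑ l, w m l) * x m j) := by
    induction n with
    | zero => simp [hw0]
    | succ n ih =>
      rw [Finset.sum_range_succ, mul_add, Real.exp_add, ← mul_assoc]
      have hstep : ∑ l, w (n + 1) l ≤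
          (∑ l, w n l) * (ε * (∑ j, w n j / (∑ l, w n l) * x n j) + 1) := by
        -- Bernoulli's inequality for exponents in [0, 1].
        have h1 : ∀ j, w (n + 1) j ≤ w n j + ε * (w n j * x n j) := by
          intro j
          rw [hw]
          have := rpow_one_add_le_one_add_mul_self (by linarith : -1 ≤ ε) (hx0 n j) (hx1 n j)
          nlinarith [hpos n j]
        have h2 : (∑ l, w n l) * ∑ j, w n j / (∑ l, w n l) * x n j = ∑ j, w n j * x n j := by
          rw [Finset.mul_sum]
          refine Finset.sum_congr rfl fun j _ => ?_
          have := (hW n).ne'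
          field_simp
        calc ∑ l, w (n + 1) l ≤ ∑ j, (w n j + ε * (w n j * x n j)) :=
              Finset.sum_le_sum fun j _ => h1 j
          _ = (∑ l, w n l) * (ε * (∑ j, w n j / (∑ l, w n l) * x n j) + 1) := by
              rw [Finset.sum_add_distrib, ← Finset.mul_sum, ← h2]; ring
      exact hstep.trans (mul_le_mul ih (Real.add_one_le_exp _)
        (add_nonneg (mul_nonneg hε (Finset.sum_nonneg fun j _ =>
          mul_nonneg (div_nonneg (hpos n j).le (hW n).le) (hx0 n j))) zero_le_one)
        (by positivity))
  have hlower : w n i = (1 + ε) ^ ∑ m ∈ Finset.range n, x m i := by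
    clear hupper
    induction n with
    | zero => simp [hw0]
    | succ n ih =>
      rw [hw, Finset.sum_range_succ, Real.rpow_add (by linarith), ih]
  have hle : w n i ≤ ∑ l, w n l :=
    Finset.single_le_sum (fun j _ => (hpos n j).le) (Finset.mem_univ i)
  -- A single weight is at most the potential; logarithms turn this into the regret bound.
  have := Real.log_le_log (hpos n i) (hle.trans hupper)
  rw [hlower, Real.log_rpow (by linarith), Real.log_mul hk.ne' (Real.exp_pos _).ne',
    Real.log_exp] at this
  linarith

theorem sub_sq_le_log_one_add {ε : ℝ} (hε : 0 ≤ ε) : ε - ε ^ 2 ≤ Real.log (1 + ε) := by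
  refine le_trans ?_ (Real.le_log_one_add_of_nonneg hε)
  rw [le_div_iff₀ (by linarith)]
  nlinarith [pow_nonneg hε 2, pow_nonneg hε 3]

/-! ## Rounds and phases -/

/-- The round at position `q` of phase `p`. -/
def phaseRound {P Q T : ℕ} (hT : P * Q ≤ T) (x : Fin P × Fin Q) : Fin T :=
  Fin.castLE hT (finProdFinEquiv x)

theorem phaseRound_injective {P Q T : ℕ} (hT : P * Q ≤ T) :
    Function.Injective (phaseRound hT) :=
  (Fin.castLE_injective hT).comp finProdFinEquiv.injective

theorem phaseRound_val_div {P Q T : ℕ} (hT : P * Q ≤ T) (x : Fin P × Fin Q) :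
    (phaseRound hT x : ℕ) / Q = x.1 := by
  have h : (phaseRound hT x : ℕ) = x.2 + Q * x.1 := rfl
  rw [h, Nat.add_mul_div_left _ _ x.2.pos, Nat.div_eq_of_lt x.2.isLt, zero_add]

theorem sum_phaseRound_le {P Q T : ℕ} (hT : P * Q ≤ T) {f : Fin T → ℝ} (h0 : ∀ t, 0 ≤ f t) :
    ∑ x, f (phaseRound hT x) ≤ ∑ t, f t := by
  refine (Finset.sum_map Finset.univ ⟨_, phaseRound_injective hT⟩ f).ge.trans ?_
  exact Finset.sum_le_sum_of_subset_of_nonneg (Finset.subset_univ _) fun t _ _ => h0 t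

theorem sum_le_sum_phaseRound_add {P Q T : ℕ} (hT : P * Q ≤ T) {f : Fin T → ℝ}
    (h1 : ∀ t, f t ≤ 1) : ∑ t, f t ≤ ∑ x, f (phaseRound hT x) + (T - P * Q) := by
  have h := sum_phaseRound_le hT (f := fun t => 1 - f t) fun t => sub_nonneg.2 (h1 t)
  simp only [Finset.sum_sub_distrib, Finset.sum_const, Finset.card_univ, Fintype.card_prod,
    Fintype.card_fin, nsmul_eq_mul, mul_one, Nat.cast_mul] at h
  linarith

namespace Exploration

variable {k P Q T : ℕ} (hT : P * Q ≤ T)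

theorem round_eq_phaseRound (e : Exploration k P Q) (p : Fin P) (i : Fin k) :
    e.round hT p i = phaseRound hT (p, e p i) := by
  refine Fin.ext ?_
  change (p : ℕ) * Q + e p i = e p i + Q * p
  ring

open Classical in
theorem sum_isExplored_le (e : Exploration k P Q) {f : Fin T → ℝ} (h1 : ∀ t, f t ≤ 1) :
    ∑ t, (if e.IsExplored hT t then f t else 0) ≤ P * k := by
  rw [← Finset.sum_filter]
  have hsub : Finset.univ.filter (e.IsExplored hT) ⊆
      Finset.univ.image fun x : Fin P × Fin k => e.round hT x.1 x.2 := by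
    intro t ht
    obtain ⟨i, p, h⟩ := (Finset.mem_filter.1 ht).2
    exact Finset.mem_image.2 ⟨(p, i), Finset.mem_univ _, h⟩
  have hcard : (Finset.univ.filter (e.IsExplored hT)).card ≤ P * k := by
    refine (Finset.card_le_card hsub).trans (Finset.card_image_le.trans ?_)
    simp
  refine (Finset.sum_le_card_nsmul _ _ 1 fun t _ => h1 t).trans ?_
  rw [nsmul_eq_mul, mul_one]
  exact_mod_cast hcard

/-- The exploration round of an agent in phase `p` is uniform in the phase and independent of
everything that does not depend on the exploration rounds of phase `p`. -/
theorem sum_mul_apply (p : Fin P) (i : Fin k) {f : Exploration k P Q → ℝ}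
    (hf : ∀ e e' : Exploration k P Q, (∀ p', p' ≠ p → e p' = e' p') → f e = f e')
    (h : Fin Q → ℝ) :
    Q * ∑ e, f e * h (e p i) = (∑ e, f e) * ∑ q, h q := by
  classical
  rcases Nat.eq_zero_or_pos Q with hQ | hQ
  · subst hQ
    simp
  have : NeZero Q := ⟨hQ.ne'⟩
  -- Rotating all positions of phase p cyclically by r permutes the explorations, preserves f and
  -- moves `e p i` by r. Averaging over r replaces `h (e p i)` by the mean of h.
  let shift : Fin Q → Exploration k P Q ≃ Exploration k P Q := fun r =>
    Equiv.piCongrRight fun p' =>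
      if p' = p then Equiv.embeddingCongr (Equiv.refl _) (Equiv.addRight r) else Equiv.refl _
  have hval : ∀ r e p', shift r e p' = (if p' = p then Equiv.embeddingCongr (Equiv.refl _)
      (Equiv.addRight r) else Equiv.refl _ : (Fin k ↪ Fin Q) ≃ (Fin k ↪ Fin Q)) (e p') :=
    fun _ _ _ => rfl
  have hshift : ∀ r, ∑ e, f e * h (e p i) = ∑ e : Exploration k P Q, f e * h (e p i + r) := by
    intro r
    rw [← Equiv.sum_comp (shift r)]
    refine Finset.sum_congr rfl fun e _ => ?_
    have h1 : f (shift r e) = f e := hf _ _ fun p' hp' => by simp [hval, hp']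
    have h2 : shift r e p i = e p i + r := by simp [hval]
    rw [h1, h2]
  calc (Q : ℝ) * ∑ e, f e * h (e p i) = ∑ r : Fin Q, ∑ e, f e * h (e p i) := by simp
    _ = ∑ r : Fin Q, ∑ e : Exploration k P Q, f e * h (e p i + r) :=
        Finset.sum_congr rfl fun r _ => hshift r
    _ = ∑ e : Exploration k P Q, f e * ∑ r : Fin Q, h (e p i + r) := by
        rw [Finset.sum_comm]; simp only [Finset.mul_sum]
    _ = (∑ e, f e) * ∑ q, h q := by
        rw [Finset.sum_mul]
        exact Finset.sum_congr rfl fun e _ => by rw [← Equiv.sum_comp (Equiv.addLeft (e p i)) h]; rfl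

end Exploration

/-! ## The regret of PSim -/

/-- The reward of playing agent `i` at round `t`, relative to the largest bid. -/
noncomputable def relGain {k T : ℕ} [NeZero k] (b : Fin k → ℝ) (ρ : Realization k T) (i : Fin k)
    (t : Fin T) : ℝ :=
  click ρ i t * b i / maxBid b

section RelGain

variable {k T : ℕ} [NeZero k] {b : Fin k → ℝ} (hb : ∀ j, 0 ≤ b j) (ρ : Realization k T)
  (i : Fin k) (t : Fin T)

include hb

theorem relGain_nonneg : 0 ≤ relGain b ρ i t :=
  div_nonneg (mul_nonneg (click_nonneg _ _ _) (hb i)) (maxBid_nonneg hb)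

theorem relGain_le_one : relGain b ρ i t ≤ 1 := by
  refine div_le_one_of_le₀ ?_ (maxBid_nonneg hb)
  calc click ρ i t * b i ≤ 1 * b i := mul_le_mul_of_nonneg_right (click_le_one _ _ _) (hb i)
    _ ≤ maxBid b := by rw [one_mul]; exact le_maxBid b i

theorem maxBid_mul_relGain : maxBid b * relGain b ρ i t = b i * click ρ i t := by
  rcases (maxBid_nonneg hb).eq_or_lt with h | h
  · have : b i = 0 := le_antisymm (h ▸ le_maxBid b i) (hb i)
    rw [← h, this]; simp
  · unfold relGain; field_simp

end RelGain

namespace Exploration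

variable {k P Q T : ℕ} [NeZero k] (hT : P * Q ≤ T) (e : Exploration k P Q) (ε : ℝ)
  (b : Fin k → ℝ) (ρ : Realization k T)

/-- The distribution over the agents used in the exploitation rounds of phase `m`. -/
noncomputable def phaseDist (m : ℕ) (i : Fin k) : ℝ :=
  e.weight hT ε b ρ m i / ∑ j, e.weight hT ε b ρ m j

theorem weight_congr_exploration {e e' : Exploration k P Q} {m : ℕ}
    (h : ∀ p : Fin P, (p : ℕ) < m → e p = e' p) (i : Fin k) :
    e.weight hT ε b ρ m i = e'.weight hT ε b ρ m i := by
  induction m with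
  | zero => simp [weight]
  | succ m ih =>
    unfold weight
    rw [ih fun p hp => h p (hp.trans m.lt_succ_self)]
    split_ifs with hm
    · have : e.round hT ⟨m, hm⟩ i = e'.round hT ⟨m, hm⟩ i := by
        rw [round_eq_phaseRound, round_eq_phaseRound, h ⟨m, hm⟩ m.lt_succ_self]
      rw [this]
    · rfl

theorem phaseDist_congr {p : Fin P} {e e' : Exploration k P Q}
    (h : ∀ p', p' ≠ p → e p' = e' p') (i : Fin k) :
    e.phaseDist hT ε b ρ p i = e'.phaseDist hT ε b ρ p i := by
  have hw := weight_congr_exploration hT ε b ρ (m := p) (e := e) (e' := e') fun p' hp' =>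
    h p' (Fin.ne_of_lt hp')
  simp only [phaseDist, hw]

variable {ε b}

/-- Multiplicative weights applied to the explored gains; this holds for each fixed exploration,
without averaging. -/
theorem sum_explored_relGain_le (hε : 0 < ε) (hb : ∀ j, 0 ≤ b j) (i : Fin k) :
    ∑ p, relGain b ρ i (e.round hT p i) ≤
      ∑ p : Fin P, ∑ j, e.phaseDist hT ε b ρ p j * relGain b ρ j (e.round hT p j) +
        (ε * P + Real.log k / ε) := by
  have h := multiplicative_weights hε.le
    -- Gains after the last phase are set to 0, which matches the weights staying constant from then
    -- on.
    (x := fun m j => if h : m < P then relGain b ρ j (e.round hT ⟨m, h⟩ j) else 0)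
    (w := e.weight hT ε b ρ)
    (fun m j => by split_ifs <;> [exact relGain_nonneg hb ρ _ _; exact le_rfl])
    (fun m j => by split_ifs <;> [exact relGain_le_one hb ρ _ _; exact zero_le_one])
    (fun j => by simp [weight])
    (fun m j => by
      rw [weight]
      split_ifs
      · rfl
      · simp) P i
  simp only [Finset.sum_range, Fin.is_lt, dite_true, Fin.eta] at h
  have hX0 : 0 ≤ ∑ p, relGain b ρ i (e.round hT p i) :=
    Finset.sum_nonneg fun p _ => relGain_nonneg hb ρ _ _
  have hXP : ∑ p, relGain b ρ i (e.round hT p i) ≤ P := by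
    simpa using Finset.sum_le_card_nsmul Finset.univ (fun p => relGain b ρ i (e.round hT p i)) 1
      fun p _ => relGain_le_one hb ρ _ _
  change _ ≤ _ + ε * ∑ p : Fin P, ∑ j, e.phaseDist hT ε b ρ p j * relGain b ρ j (e.round hT p j)
    at h
  set X := ∑ p, relGain b ρ i (e.round hT p i)
  set Y := ∑ p : Fin P, ∑ j, e.phaseDist hT ε b ρ p j * relGain b ρ j (e.round hT p j)
  -- Replacing log(1 + ε) by ε - ε² costs at most ε²P because X ≤ P; division by ε then gives the
  -- claim.
  have h1 := (mul_le_mul_of_nonneg_right (sub_sq_le_log_one_add hε.le) hX0).trans h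
  have h2 : ε ^ 2 * X ≤ ε ^ 2 * P := mul_le_mul_of_nonneg_left hXP (sq_nonneg ε)
  refine le_of_mul_le_mul_left ?_ hε
  have h3 : ε * (Y + (ε * P + Real.log k / ε)) = ε * Y + ε ^ 2 * P + Real.log k := by
    field_simp
    ring
  rw [h3]
  linarith

/-- The left side pretends that every round of every phase exploits. Only the at most Pk exploration
rounds differ, each worth at most 1, and the gains after the last phase are nonnegative. -/
theorem sum_phaseDist_relGain_le (hε : 0 ≤ ε) (hb : ∀ j, 0 ≤ b j) :
    ∑ x : Fin P × Fin Q, ∑ j, e.phaseDist hT ε b ρ x.1 j * relGain b ρ j (phaseRound hT x) ≤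
      ∑ t, ∑ j, e.condProb hT ε b ρ t j * relGain b ρ j t + P * k := by
  classical
  set f : Fin T → ℝ := fun t => ∑ j, e.dist hT ε b ρ t j * relGain b ρ j t with hf
  have hf0 : ∀ t, 0 ≤ f t := fun t => Finset.sum_nonneg fun j _ =>
    mul_nonneg (e.dist_pos hT hε b ρ t j).le (relGain_nonneg hb ρ j t)
  have hf1 : ∀ t, f t ≤ 1 := by
    intro t
    rw [← e.sum_dist hT hε b ρ t]
    exact Finset.sum_le_sum fun j _ =>
      mul_le_of_le_one_right (e.dist_pos hT hε b ρ t j).le (relGain_le_one hb ρ j t)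
  have h1 : ∑ x : Fin P × Fin Q, ∑ j, e.phaseDist hT ε b ρ x.1 j *
      relGain b ρ j (phaseRound hT x) = ∑ x, f (phaseRound hT x) := by
    refine Finset.sum_congr rfl fun x _ => ?_
    simp only [hf, dist, phaseRound_val_div]
    rfl
  have h2 : ∑ t, f t ≤ ∑ t, (∑ j, e.condProb hT ε b ρ t j * relGain b ρ j t +
      if e.IsExplored hT t then f t else 0) := by
    refine Finset.sum_le_sum fun t _ => ?_
    split_ifs with h
    · exact le_add_of_nonneg_left (Finset.sum_nonneg fun j _ =>
        mul_nonneg (e.condProb_nonneg hT ε b ρ t j) (relGain_nonneg hb ρ j t))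
    · simp only [e.condProb_of_not_isExplored b ρ hε h, add_zero]
      exact le_rfl
  rw [Finset.sum_add_distrib] at h2
  linarith [sum_phaseRound_le hT hf0, e.sum_isExplored_le hT hf1]

variable [Nonempty (Exploration k P Q)]

/-- The relative reward of an agent exceeds the expected relative reward of PSim by little. -/
theorem sum_relGain_le (hε : 0 < ε) (hb : ∀ j, 0 ≤ b j) (i : Fin k) :
    ∑ t, relGain b ρ i t ≤ (Fintype.card (Exploration k P Q) : ℝ)⁻¹ *
        ∑ e : Exploration k P Q, ∑ t, ∑ j, e.condProb hT ε b ρ t j * relGain b ρ j t +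
      (P * k + Q * (ε * P + Real.log k / ε) + (T - P * Q)) := by
  set N : ℝ := (Fintype.card (Exploration k P Q) : ℝ) with hN
  have hNpos : 0 < N := Nat.cast_pos.2 Fintype.card_pos
  have hbest : N * ∑ x, relGain b ρ i (phaseRound hT x) =
      Q * ∑ e : Exploration k P Q, ∑ p, relGain b ρ i (e.round hT p i) := by
    rw [Finset.sum_comm, Finset.mul_sum, Fintype.sum_prod_type, Finset.mul_sum]
    refine Finset.sum_congr rfl fun p _ => ?_
    have := sum_mul_apply p i (f := fun _ : Exploration k P Q => 1) (fun _ _ _ => rfl)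
      fun q => relGain b ρ i (phaseRound hT (p, q))
    simp only [one_mul, Finset.sum_const, Finset.card_univ, nsmul_eq_mul, mul_one] at this
    simp only [round_eq_phaseRound]
    rw [← Finset.mul_sum]
    exact this.symm
  -- The distribution of phase p depends only on earlier phases, so it is independent of the
  -- exploration rounds of phase p.
  have hexp : ∑ e : Exploration k P Q, ∑ x : Fin P × Fin Q, ∑ j,
      e.phaseDist hT ε b ρ x.1 j * relGain b ρ j (phaseRound hT x) =
      Q * ∑ e : Exploration k P Q, ∑ p : Fin P, ∑ j,
        e.phaseDist hT ε b ρ p j * relGain b ρ j (e.round hT p j) := by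
    have h1 : ∀ (p : Fin P) (j : Fin k), (Q : ℝ) * ∑ e : Exploration k P Q,
        e.phaseDist hT ε b ρ p j * relGain b ρ j (e.round hT p j) =
        ∑ e : Exploration k P Q, ∑ q : Fin Q,
          e.phaseDist hT ε b ρ p j * relGain b ρ j (phaseRound hT (p, q)) := by
      intro p j
      simp only [round_eq_phaseRound]
      rw [sum_mul_apply p j (f := fun e => e.phaseDist hT ε b ρ p j)
        (fun e e' h => phaseDist_congr hT ε b ρ h j)
        fun q => relGain b ρ j (phaseRound hT (p, q)), Finset.sum_mul]
      simp only [Finset.mul_sum]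
    calc _ = ∑ p : Fin P, ∑ j, ∑ e : Exploration k P Q, ∑ q : Fin Q,
          e.phaseDist hT ε b ρ p j * relGain b ρ j (phaseRound hT (p, q)) := by
          simp only [Fintype.sum_prod_type]
          rw [Finset.sum_comm]
          refine Finset.sum_congr rfl fun p _ => ?_
          rw [Finset.sum_comm (s := (Finset.univ : Finset (Fin k)))]
          exact Finset.sum_congr rfl fun e _ => Finset.sum_comm
      _ = _ := by
          simp only [← h1]
          rw [Finset.sum_comm (s := (Finset.univ : Finset (Exploration k P Q))), Finset.mul_sum]
          simp only [← Finset.mul_sum]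
          congr 1
          exact Finset.sum_congr rfl fun p _ => Finset.sum_comm
  have hhedge := Finset.sum_le_sum fun (e : Exploration k P Q) (_ : e ∈ Finset.univ) =>
    e.sum_explored_relGain_le hT ρ hε hb i
  have hplay := Finset.sum_le_sum fun (e : Exploration k P Q) (_ : e ∈ Finset.univ) =>
    e.sum_phaseDist_relGain_le hT ρ hε.le hb
  simp only [Finset.sum_add_distrib, Finset.sum_const, Finset.card_univ, nsmul_eq_mul, ← hN]
    at hhedge hplay
  have hQ := mul_le_mul_of_nonneg_left hhedge (Nat.cast_nonneg (α := ℝ) Q)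
  rw [← hbest, mul_add, ← hexp] at hQ
  have hphases := sum_le_sum_phaseRound_add hT (f := relGain b ρ i) fun t => relGain_le_one hb ρ i t
  refine le_of_mul_le_mul_left ?_ hNpos
  rw [mul_add, mul_inv_cancel_left₀ hNpos.ne']
  have := mul_le_mul_of_nonneg_left hphases hNpos.le
  linarith

end Exploration

section Regret

variable {k T : ℕ} [NeZero k] {b : Fin k → ℝ} (hb : ∀ j, 0 ≤ b j) (ρ : Realization k T)

include hb

theorem sup_welfare_le {c : ℝ} (h : ∀ i, ∑ t, relGain b ρ i t ≤ c) :
    (Finset.univ.sup' Finset.univ_nonempty fun i => b i * ∑ t, click ρ i t) ≤ maxBid b * c := by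
  refine Finset.sup'_le _ _ fun i _ => ?_
  rw [Finset.mul_sum]
  simp only [← maxBid_mul_relGain hb]
  rw [← Finset.mul_sum]
  exact mul_le_mul_of_nonneg_left (h i) (maxBid_nonneg hb)

/-- The regret is at most the number of rounds times the largest value. -/
theorem regret_le_maxBid_mul (A : AllocationRule k T) : A.regret b ρ ≤ maxBid b * T := by
  have h1 := sup_welfare_le hb ρ (c := T) fun i => by
    simpa using Finset.sum_le_card_nsmul Finset.univ (relGain b ρ i) 1
      fun t _ => relGain_le_one hb ρ i t
  have h2 : 0 ≤ ∑ t, ∑ i, b i * click ρ i t * A.playProb b ρ t i :=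
    Finset.sum_nonneg fun t _ => Finset.sum_nonneg fun i _ =>
      mul_nonneg (mul_nonneg (hb i) (click_nonneg _ _ _)) measureReal_nonneg
  unfold AllocationRule.regret
  linarith

theorem regret_psim_le {P : ℕ} (hP : P * k ≤ T) {ε : ℝ} (hε : 0 < ε) :
    (psim k T P ε hP).regret b ρ ≤ maxBid b * (P * k + (T / P : ℕ) * (ε * P + Real.log k / ε) +
      (T - P * (T / P : ℕ))) := by
  have hT := Nat.mul_div_le T P
  have : Nonempty (Exploration k P (T / P)) :=
    Exploration.nonempty_of_le fun h => (Nat.le_div_iff_mul_le h).2 (by rwa [mul_comm])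
  have h1 := sup_welfare_le hb ρ fun i => Exploration.sum_relGain_le hT ρ hε hb i
  have h2 : ∑ t, ∑ i, b i * click ρ i t * (psim k T P ε hP).playProb b ρ t i =
      maxBid b * ((Fintype.card (Exploration k P (T / P)) : ℝ)⁻¹ *
        ∑ e : Exploration k P (T / P), ∑ t, ∑ j,
          e.condProb hT ε b ρ t j * relGain b ρ j t) := by
    simp only [playProb_psim, ← maxBid_mul_relGain hb]
    rw [Finset.sum_comm (s := (Finset.univ : Finset (Exploration k P (T / P))))]
    simp only [Finset.mul_sum]
    refine Finset.sum_congr rfl fun t _ => ?_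
    rw [Finset.sum_comm]
    refine Finset.sum_congr rfl fun i _ => Finset.sum_congr rfl fun e _ => ?_
    ring
  unfold AllocationRule.regret
  rw [h2]
  rw [mul_add] at h1
  linarith

omit hb in
/-- There is no regret if there is only one agent. -/
theorem regret_nonpos_of_subsingleton [Subsingleton (Fin k)] (A : AllocationRule k T) :
    A.regret b ρ ≤ 0 := by
  have hplay : ∀ t i, A.playProb b ρ t i = 1 := by
    intro t i
    have : {ω | A.alloc ω b ρ t = i} = Set.univ :=
      Set.eq_univ_of_forall fun ω => Subsingleton.elim _ _
    rw [AllocationRule.playProb, this, probReal_univ]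
  unfold AllocationRule.regret
  rw [sub_nonpos]
  refine Finset.sup'_le _ _ fun i _ => ?_
  simp only [hplay, mul_one]
  rw [Finset.mul_sum]
  exact (Finset.sum_congr rfl fun t _ =>
    (Fintype.sum_subsingleton (fun i => b i * click ρ i t) i).symm).le

end Regret

/-! ## The choice of the parameters -/

theorem psimRate_nonneg (k T : ℕ) : 0 ≤ psimRate k T := by
  rcases Nat.eq_zero_or_pos k with rfl | hk
  · simp [psimRate]
  · have : 0 ≤ Real.log k := Real.log_natCast_nonneg k
    unfold psimRate
    positivity

/-- When there are few rounds, the trivial regret bound T is already good enough; the factor 2 is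
the cube root of 8. -/
theorem cast_le_of_le_eight_mul {k T : ℕ} (h : (T : ℝ) ≤ 8 * (k * Real.log k)) :
    (T : ℝ) ≤ 2 * ((k : ℝ) * Real.log k) ^ (1 / 3 : ℝ) * (T : ℝ) ^ (2 / 3 : ℝ) := by
  have hT : (0 : ℝ) ≤ T := Nat.cast_nonneg T
  have h0 : 0 ≤ (k : ℝ) * Real.log k := mul_nonneg (Nat.cast_nonneg k) (Real.log_natCast_nonneg k)
  calc (T : ℝ) = (T : ℝ) ^ (1 / 3 : ℝ) * (T : ℝ) ^ (2 / 3 : ℝ) := by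
        rw [← Real.rpow_add_of_nonneg hT (by norm_num) (by norm_num)]; norm_num
    _ ≤ (8 * (k * Real.log k)) ^ (1 / 3 : ℝ) * (T : ℝ) ^ (2 / 3 : ℝ) := by gcongr
    _ = _ := by
        rw [Real.mul_rpow (by norm_num) h0]
        congr 2
        rw [show (8 : ℝ) = 2 ^ (3 : ℝ) by norm_num, ← Real.rpow_mul (by norm_num)]
        norm_num

/-- The regret bound for the parameters of `tunedPSim`, if there are enough rounds. -/
theorem psimPhases_bound {k T : ℕ} (hk : 2 ≤ k) (h : 8 * (k * Real.log k) < (T : ℝ)) :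
    (psimPhases k T * k + (T / psimPhases k T : ℕ) *
        (psimRate k T * psimPhases k T + Real.log k / psimRate k T) +
      (T - psimPhases k T * (T / psimPhases k T : ℕ)) : ℝ) ≤
      5 * ((k : ℝ) * Real.log k) ^ (1 / 3 : ℝ) * (T : ℝ) ^ (2 / 3 : ℝ) := by
  have hk2 : (2 : ℝ) ≤ k := by exact_mod_cast hk
  have hk0 : (0 : ℝ) < k := by linarith
  have hL : 1 / 2 < Real.log k :=
    lt_of_lt_of_le (by linarith [Real.log_two_gt_d9]) (Real.log_le_log two_pos hk2)
  set L := Real.log k with hLdef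
  have hL0 : 0 < L := by linarith
  have hT0 : (0 : ℝ) < T := lt_trans (by positivity) h
  -- Cube roots of k, log k and T turn all fractional powers into integer powers.
  obtain ⟨κ, hκ0, hκ⟩ : ∃ κ : ℝ, 0 < κ ∧ κ ^ 3 = k :=
    ⟨(k : ℝ) ^ (1 / 3 : ℝ), by positivity, by
      rw [← Real.rpow_natCast, ← Real.rpow_mul hk0.le]; norm_num⟩
  obtain ⟨l, hl0, hl⟩ : ∃ l : ℝ, 0 < l ∧ l ^ 3 = L :=
    ⟨L ^ (1 / 3 : ℝ), by positivity, by
      rw [← Real.rpow_natCast, ← Real.rpow_mul hL0.le]; norm_num⟩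
  obtain ⟨τ, hτ0, hτ⟩ : ∃ τ : ℝ, 0 < τ ∧ τ ^ 3 = T :=
    ⟨(T : ℝ) ^ (1 / 3 : ℝ), by positivity, by
      rw [← Real.rpow_natCast, ← Real.rpow_mul hT0.le]; norm_num⟩
  have root : ∀ {z : ℝ}, 0 < z → (z ^ 3) ^ (1 / 3 : ℝ) = z := by
    intro z hz
    rw [← Real.rpow_natCast, ← Real.rpow_mul hz.le]; norm_num
  have root2 : ∀ {z : ℝ}, 0 < z → (z ^ 3) ^ (2 / 3 : ℝ) = z ^ 2 := by
    intro z hz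
    rw [← Real.rpow_natCast, ← Real.rpow_mul hz.le]; norm_num
  have hrate : psimRate k T = κ * l / τ := by
    rw [psimRate, ← hLdef, ← hκ, ← hl, ← hτ, ← mul_pow, ← div_pow, root (by positivity)]
  have hB : ((k : ℝ) * L) ^ (1 / 3 : ℝ) * (T : ℝ) ^ (2 / 3 : ℝ) = κ * l * τ ^ 2 := by
    rw [← hκ, ← hl, ← hτ, ← mul_pow, root (by positivity), root2 hτ0]
  -- The number of phases before rounding.
  set a := l * (τ / κ) ^ 2 with ha
  have hτκ : 2 * (κ * l) < τ := by
    refine lt_of_pow_lt_pow_left₀ 3 hτ0.le ?_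
    rw [hτ, mul_pow, mul_pow, hκ, hl]
    linarith
  have hlτ : 2 * l < τ / κ := by rw [lt_div_iff₀ hκ0]; linarith
  -- Here a > 4 l³ = 4 log k > 2.
  have ha1 : 1 ≤ a := by
    have h1 : (2 * l) ^ 2 < (τ / κ) ^ 2 := pow_lt_pow_left₀ hlτ (by positivity) two_ne_zero
    have h2 : l * (2 * l) ^ 2 < a := mul_lt_mul_of_pos_left h1 hl0
    nlinarith
  -- The cap `T / k` is inactive: l ≤ τ/κ gives a ≤ (τ/κ)³ = T/k.
  have hphases : psimPhases k T = ⌊a⌋₊ := by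
    have h1 : Real.log k ^ (1 / 3 : ℝ) * ((T : ℝ) / k) ^ (2 / 3 : ℝ) = a := by
      rw [← hLdef, ← hκ, ← hl, ← hτ, ← div_pow, root hl0, root2 (by positivity)]
    rw [psimPhases, h1, min_eq_left]
    rw [← Nat.floor_div_eq_div (K := ℝ)]
    refine Nat.floor_le_floor ?_
    rw [← hκ, ← hτ, ← div_pow, pow_succ, mul_comm]
    exact mul_le_mul_of_nonneg_right (by linarith) (by positivity)
  set n := psimPhases k T
  have hn1 : 1 ≤ n := by rw [hphases]; exact Nat.le_floor (by exact_mod_cast ha1)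
  have hna : (n : ℝ) ≤ a := by rw [hphases]; exact Nat.floor_le (by positivity)
  -- Rounding down loses at most a factor 2 because n ≥ 1.
  have han : a ≤ 2 * n := by
    have := Nat.lt_floor_add_one a
    rw [← hphases] at this
    have : (1 : ℝ) ≤ n := by exact_mod_cast hn1
    linarith
  have hn0 : (0 : ℝ) < n := by exact_mod_cast hn1
  have hrem : (T : ℝ) - n * (T / n : ℕ) ≤ n := by
    have h1 := (Nat.mod_lt T hn1).le
    have h2 : (n : ℝ) * (T / n : ℕ) + (T % n : ℕ) = T := by exact_mod_cast Nat.div_add_mod T n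
    have h3 : ((T % n : ℕ) : ℝ) ≤ n := by exact_mod_cast h1
    linarith
  have hQ : ((T / n : ℕ) : ℝ) ≤ T / n := Nat.cast_div_le
  have hkn : n * k ≤ κ * l * τ ^ 2 := by
    calc (n : ℝ) * k ≤ a * k := by gcongr
      _ = κ * l * τ ^ 2 := by rw [ha, ← hκ]; field_simp
  have hnk : (n : ℝ) ≤ n * k := le_mul_of_one_le_right hn0.le (by linarith)
  have hlearn : (T / n : ℕ) * (psimRate k T * n + L / psimRate k T) ≤ 3 * (κ * l * τ ^ 2) := by
    rw [hrate]
    calc ((T / n : ℕ) : ℝ) * (κ * l / τ * n + L / (κ * l / τ))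
        ≤ T / n * (κ * l / τ * n + L / (κ * l / τ)) := by gcongr
      _ = κ * l * τ ^ 2 + (l ^ 2 * τ ^ 4 / κ) / n := by
          rw [← hl, ← hτ]; field_simp
      _ ≤ κ * l * τ ^ 2 + (l ^ 2 * τ ^ 4 / κ) / (a / 2) := by gcongr; linarith
      _ = 3 * (κ * l * τ ^ 2) := by rw [ha]; field_simp; ring
  -- In units of κ l τ², exploration costs 1, learning 3 and the leftover rounds 1, which is the
  -- constant 5.
  rw [mul_assoc, hB]
  linarith

theorem mainTheorem8 :
    ∃ C : ℝ, 0 < C ∧ ∀ (k T : ℕ) [NeZero k],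
      ∃ P : PaymentRule (tunedPSim k T),
        P.IsNormalized ∧ P.IsWeaklyTruthful ∧
          ∀ vmax : ℝ, 0 ≤ vmax →
            (tunedPSim k T).worstCaseRegret vmax ≤
              ((C * ((k : ℝ) * Real.log k) ^ (1 / 3 : ℝ) * (T : ℝ) ^ (2 / 3 : ℝ) * vmax : ℝ) :
                EReal) := by
  refine ⟨5, by norm_num, fun k T _ => ⟨psimPayment k T _ _ _,
    psimPayment_isNormalized (psimRate_nonneg k T),
    psimPayment_isWeaklyTruthful (psimRate_nonneg k T), fun vmax hvmax => ?_⟩⟩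
  refine iSup_le fun v => iSup_le fun hv => iSup_le fun ρ => EReal.coe_le_coe_iff.2 ?_
  have hv0 : ∀ j, 0 ≤ v j := fun j => (hv j).1
  have hM : maxBid v ≤ vmax := Finset.sup'_le _ _ fun j _ => (hv j).2
  have hL : 0 ≤ (k : ℝ) * Real.log k :=
    mul_nonneg (Nat.cast_nonneg k) (Real.log_natCast_nonneg k)
  rw [mul_comm _ vmax]
  have hscale : ∀ {c : ℝ}, c ≤ 5 * ((k : ℝ) * Real.log k) ^ (1 / 3 : ℝ) * (T : ℝ) ^ (2 / 3 : ℝ) →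
      maxBid v * c ≤ vmax * (5 * ((k : ℝ) * Real.log k) ^ (1 / 3 : ℝ) * (T : ℝ) ^ (2 / 3 : ℝ)) :=
    fun hc => mul_le_mul_of_nonneg hM hc (maxBid_nonneg hv0) (by positivity)
  rcases (Nat.one_le_iff_ne_zero.2 (NeZero.ne k)).eq_or_lt with rfl | hk
  -- For k = 1 the rate is 0 and the learning bound does not apply, but a sole agent leaves no
  -- regret.
  · exact (regret_nonpos_of_subsingleton ρ _).trans (by positivity)
  rcases le_or_gt (T : ℝ) (8 * (k * Real.log k)) with h | h
  · refine (regret_le_maxBid_mul hv0 ρ _).trans (hscale ((cast_le_of_le_eight_mul h).trans ?_))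
    gcongr
    norm_num
  · have hε : 0 < psimRate k T := by
      have h1 : 0 < Real.log k := Real.log_pos (by exact_mod_cast hk)
      have h2 : (0 : ℝ) < T := lt_of_le_of_lt (by positivity) h
      have h3 : (0 : ℝ) < k := by positivity
      unfold psimRate
      positivity
    exact (regret_psim_le hv0 ρ _ hε).trans (hscale (psimPhases_bound hk h))
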